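/- Let $\mathsf X$ be a denumerable set of variables. The terms of $\Lambda_\oplus$ are given by $M,N ::= x \mid \lambda x.M \mid MN \mid M\oplus N$ with $x\in\mathsf X$, and are taken up to renaming of bound variables. For a finite $\overline x\subseteq\mathsf X$, $\Lambda_\oplus(\overline x)$ is the set of terms whose free variables lie in $\overline x$. Terms in $\Lambda_\oplus(\emptyset)$ are called closed, and the set of values $\mathsf V\Lambda_\oplus$ consists of the closed abstractions. *Semantics.* The judgments $M\Downarrow\mathscr D$, with $M$ closed and $\mathscr D$ a finitely supported subprobability distribution on $\mathsf V\Lambda_\oplus$, are derived inductively as follows: $M\Downarrow\emptyset$ (the zero distribution) for every closed $M$; $V\Downarrow\{V\}$ (the point mass at $V$) for every value $V$; if $M\Downarrow\mathscr D$ and $P\{N/x\}\Downarrow\mathscr E_{P,N}$ for every $\lambda x.P$ in the support of $\mathscr D$, then $MN\Downarrow\sum_{\lambda x.P\in\mathrm{supp}(\mathscr D)}\mathscr D(\lambda x.P)\cdot\mathscr E_{P,N}$; if $M\Downarrow\mathscr D$ and $N\Downarrow\mathscr E$, then $M\oplus N\Downarrow\frac12\mathscr D+\frac12\mathscr E$.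 The call-by-name semantics of $M$ is the pointwise supremum $[\![M]\!]=\sup_{M\Downarrow\mathscr D}\mathscr D$. *Markov chain.* Consider the labelled Markov chain with set of states the disjoint union $\mathcal S=\Lambda_\oplus(\emptyset)\uplus\mathsf V\Lambda_\oplus$ (the elements of the second component, written $\nu x.N$, are called distinguished values; the two components are the two sorts), with labels $\Lambda_\oplus(\emptyset)\uplus\{\tau\}$, and with transition probabilities $\mathcal P(M,\tau,\nu x.N)=[\![M]\!](\lambda x.N)$ and $\mathcal P(\nu x.N,M,N\{M/x\})=1$ for every closed term $M$ and every distinguished value $\nu x.N$, and $\mathcal P=0$ in all other cases. Write $\mathcal P(s,\ell,X)=\sum_{t\in X}\mathcal P(s,\ell,t)$ for $X\subseteq\mathcal S$. A *probabilistic applicative simulation* is a preorder $\mathcal R$ on $\mathcal S$ that only relates states of the same sort and is such that $s\,\mathcal R\,t$ implies $\mathcal P(s,\ell,X)\le\mathcal P(t,\ell,\mathcal R(X))$ for every label $\ell$ and every $X\subseteq\mathcal S$, where $\mathcal R(X)=\{y\mid\exists x\in X,\ x\,\mathcal R\,y\}$. A *probabilistic applicative bisimulation* is an equivalence relation $\mathcal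 R$ on $\mathcal S$ that only relates states of the same sort and is such that $s\,\mathcal R\,t$ implies $\mathcal P(s,\ell,E)=\mathcal P(t,\ell,E)$ for every label $\ell$ and every equivalence class $E$ of $\mathcal R$. *Probabilistic applicative similarity* $\lesssim$ (respectively *bisimilarity* $\sim$) is the union of all probabilistic applicative simulations (respectively bisimulations), restricted to closed terms. Both are extended to open terms by closing substitutions: for $M,N\in\Lambda_\oplus(\overline x)$, $\overline x\vdash M\lesssim N$ holds if and only if $M\sigma\lesssim N\sigma$ for every substitution $\sigma$ of closed terms for the variables in $\overline x$, and similarly for $\sim$. *Congruences.* A $\Lambda_\oplus$-relation is a set $\mathcal R$ of triples $(\overline x,M,N)$ with $\overline x\subseteq\mathsf X$ finite and $M,N\in\Lambda_\oplus(\overline x)$, written $\overline x\vdash M\,\mathcal R\,N$. It is *compatible* if, for every finite $\overline x\subseteq\mathsf X$: 1. $\overline x\vdash x\,\mathcal R\,x$ for all $x\in\overline x$; 2. for all $x\in\mathsf X\setminus\overline x$ and $M,N\in\Lambda_\oplus(\overline x\cup\{x\})$, $\overline x\cup\{x\}\vdash M\,\mathcal R\,N$ implies $\overline x\vdash\lambda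 x.M\,\mathcal R\,\lambda x.N$; 3. for all $M,N,L,P\in\Lambda_\oplus(\overline x)$, $\overline x\vdash M\,\mathcal R\,N$ and $\overline x\vdash L\,\mathcal R\,P$ imply $\overline x\vdash ML\,\mathcal R\,NP$; 4. for all $M,N,L,P\in\Lambda_\oplus(\overline x)$, $\overline x\vdash M\,\mathcal R\,N$ and $\overline x\vdash L\,\mathcal R\,P$ imply $\overline x\vdash M\oplus L\,\mathcal R\,N\oplus P$. A *precongruence* (respectively *congruence*) is a compatible $\Lambda_\oplus$-relation that is, for every $\overline x$, a preorder (respectively an equivalence relation) on $\Lambda_\oplus(\overline x)$. **Theorem.** Probabilistic applicative similarity $\lesssim$ is a precongruence, and probabilistic applicative bisimilarity $\sim$ is a congruence. -/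

import Mathlib

open scoped NNReal ENNReal

noncomputable section

namespace ProbLambda

/-! ## Terms -/

/-- The denumerable set of variables. -/
abbrev Var : Type := ℕ

/-- Terms of the probabilistic lambda-calculus, up to renaming of bound variables: free variables
are elements of `A`, and bound variables are de Bruijn indices. A term of `Tm A n` lies below `n`
pending binders, `bvar 0` being bound by the innermost one. So `Tm A 0` is the set of
alpha-equivalence classes of terms whose free variables are among the elements of `A`. -/
inductive Tm (A : Type) : ℕ → Type
  | fvar {n : ℕ} (a : A) : Tm A n
  | bvar {n : ℕ} (i : Fin n) : Tm A n
  | lam {n : ℕ} (M : Tm A (n + 1)) : Tm A n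
  | app {n : ℕ} (M N : Tm A n) : Tm A n
  | choice {n : ℕ} (M N : Tm A n) : Tm A n

namespace Tm

variable {A B : Type}

/-- Renaming of bound variables. -/
def rename : {n m : ℕ} → (Fin n → Fin m) → Tm A n → Tm A m
  | _, _, _, fvar a => fvar a
  | _, _, ρ, bvar i => bvar (ρ i)
  | _, _, ρ, lam M => lam (rename (Fin.cases 0 (fun i => (ρ i).succ)) M)
  | _, _, ρ, app M N => app (rename ρ M) (rename ρ N)
  | _, _, ρ, choice M N => choice (rename ρ M) (rename ρ N)

/-- Moving a term below one more binder. -/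
def shift {n : ℕ} (M : Tm A n) : Tm A (n + 1) := rename Fin.succ M

/-- Simultaneous capture-avoiding substitution: `σ` for the free variables, `θ` for the indices. -/
def subst : {n m : ℕ} → (A → Tm B m) → (Fin n → Tm B m) → Tm A n → Tm B m
  | _, _, σ, _, fvar a => σ a
  | _, _, _, θ, bvar i => θ i
  | _, _, σ, θ, lam M =>
      lam (subst (fun a => shift (σ a)) (Fin.cases (bvar 0) (fun i => shift (θ i))) M)
  | _, _, σ, θ, app M N => app (subst σ θ M) (subst σ θ N)
  | _, _, σ, θ, choice M N => choice (subst σ θ M) (subst σ θ N)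

/-- If `P` is the body of the abstraction `λx.P`, this is `P{N/x}`. -/
def inst (P : Tm A 1) (N : Tm A 0) : Tm A 0 := subst fvar (fun _ => N) P

/-- The term is an abstraction. -/
def IsLam : {n : ℕ} → Tm A n → Prop
  | _, lam _ => True
  | _, _ => False

/-- A numerical code, used only to see that there are countably many terms. -/
def code (e : A → ℕ) : {n : ℕ} → Tm A n → ℕ
  | _, fvar a => Nat.pair 0 (e a)
  | _, bvar i => Nat.pair 1 i
  | _, lam M => Nat.pair 2 (code e M)
  | _, app M N => Nat.pair 3 (Nat.pair (code e M) (code e N))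
  | _, choice M N => Nat.pair 4 (Nat.pair (code e M) (code e N))

theorem code_injective {e : A → ℕ} (he : Function.Injective e) :
    ∀ {n : ℕ} (M N : Tm A n), code e M = code e N → M = N := by
  intro n M
  induction M with
  | fvar a => intro N h; cases N <;> simp_all [code, he.eq_iff]
  | bvar i => intro N h; cases N <;> simp_all [code, Fin.val_inj]
  | lam M ih =>
      intro N h
      cases N <;> simp only [code, Nat.pair_eq_pair] at h <;> try omega
      rw [ih _ h.2]
  | app M M' ih ih' =>
      intro N h
      cases N <;> simp only [code, Nat.pair_eq_pair] at h <;> try omega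
      rw [ih _ h.2.1, ih' _ h.2.2]
  | choice M M' ih ih' =>
      intro N h
      cases N <;> simp only [code, Nat.pair_eq_pair] at h <;> try omega
      rw [ih _ h.2.1, ih' _ h.2.2]

instance [Countable A] (n : ℕ) : Countable (Tm A n) := by
  obtain ⟨e, he⟩ := exists_injective_nat A
  exact Function.Injective.countable (f := code e) fun M N h => code_injective he M N h

end Tm

/-- The set of terms whose free variables are among those of the finite set `xs`. -/
abbrev Term (xs : Finset Var) : Type := Tm {x : Var // x ∈ xs} 0

/-- Closed terms. -/
abbrev Closed : Type := Term ∅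

/-- The abstraction `λx.M`. -/
def abs {xs : Finset Var} (x : Var) (M : Term (insert x xs)) : Term xs :=
  Tm.lam (Tm.subst
    (fun y => if h : y.1 = x then Tm.bvar 0
      else Tm.fvar ⟨y.1, Finset.mem_of_mem_insert_of_ne y.2 h⟩)
    Fin.elim0 M)

/-- The result of replacing every free variable `x` of `M` by the closed term `σ x`. -/
def close {xs : Finset Var} (σ : {x : Var // x ∈ xs} → Closed) (M : Term xs) : Closed :=
  Tm.subst σ Fin.elim0 M

/-- Values: closed abstractions. -/
def Value : Type := {M : Closed // M.IsLam}

instance : Countable Value := Subtype.countable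

/-- The value `λx.P`, given by its body `P`. -/
def Value.mk (P : Tm {x : Var // x ∈ (∅ : Finset Var)} 1) : Value := ⟨Tm.lam P, trivial⟩

/-- The body `P` of the value `λx.P`. -/
def Value.body : Value → Tm {x : Var // x ∈ (∅ : Finset Var)} 1
  | ⟨Tm.lam P, _⟩ => P

/-! ## Call-by-name semantics -/

/-- Big-step approximation semantics: `BigStep M D` means that `D`, a value distribution of finite
support, is derivable as a lower approximation to the semantics of `M`. -/
inductive BigStep : Closed → (Value →₀ ℝ≥0) → Prop
  | bt (M : Closed) : BigStep M 0
  | bv (P : Tm {x : Var // x ∈ (∅ : Finset Var)} 1) :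
      BigStep (Tm.lam P) (Finsupp.single (Value.mk P) 1)
  | ba {M N : Closed} {D : Value →₀ ℝ≥0} (E : Value → (Value →₀ ℝ≥0))
      (hM : BigStep M D) (hE : ∀ V ∈ D.support, BigStep (V.body.inst N) (E V)) :
      BigStep (Tm.app M N) (∑ V ∈ D.support, D V • E V)
  | bs {M N : Closed} {D E : Value →₀ ℝ≥0} (hM : BigStep M D) (hN : BigStep N E) :
      BigStep (Tm.choice M N) ((1 / 2 : ℝ≥0) • D + (1 / 2 : ℝ≥0) • E)

theorem sum_superset {D : Value →₀ ℝ≥0} {s : Finset Value} (h : D.support ⊆ s)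
    (E : Value → (Value →₀ ℝ≥0)) :
    ∑ V ∈ D.support, D V • E V = ∑ V ∈ s, D V • E V := by
  refine Finset.sum_subset h fun V _ hV => ?_
  rw [Finsupp.notMem_support_iff.1 hV, zero_smul]

/-- The lower approximations to the semantics of a term form a directed set. -/
theorem BigStep.directed {M : Closed} {D : Value →₀ ℝ≥0} (h : BigStep M D) :
    ∀ {D' : Value →₀ ℝ≥0}, BigStep M D' → ∃ F, BigStep M F ∧ D ≤ F ∧ D' ≤ F := by
  classical
  induction h with
  | bt M => exact fun {D'} h' => ⟨D', h', zero_le, le_rfl⟩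
  | bv P =>
      intro D' h'
      cases h' with
      | bt => exact ⟨_, .bv P, le_rfl, zero_le⟩
      | bv => exact ⟨_, .bv P, le_rfl, le_rfl⟩
  | @bs M N D E hM hN ihM ihN =>
      intro D' h'
      cases h' with
      | bt => exact ⟨_, .bs hM hN, le_rfl, zero_le⟩
      | bs hM' hN' =>
          obtain ⟨F, hF, h1, h2⟩ := ihM hM'
          obtain ⟨G, hG, h3, h4⟩ := ihN hN'
          refine ⟨_, .bs hF hG, ?_, ?_⟩ <;> intro V <;>
            simp only [Finsupp.add_apply, Finsupp.smul_apply, smul_eq_mul] <;> gcongr <;> apply_assumption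
  | @ba M N D E hM hE ihM ihE =>
      intro D' h'
      cases h' with
      | bt => exact ⟨_, .ba E hM hE, le_rfl, zero_le⟩
      | @ba _ _ D' E' hM' hE' =>
          obtain ⟨F, hF, h1, h2⟩ := ihM hM'
          have key : ∀ V, ∃ G, BigStep (V.body.inst N) G ∧
              (V ∈ D.support → E V ≤ G) ∧ (V ∈ D'.support → E' V ≤ G) := by
            intro V
            by_cases hV : V ∈ D.support <;> by_cases hV' : V ∈ D'.support
            · obtain ⟨G, hG, h3, h4⟩ := ihE V hV (hE' V hV')
              exact ⟨G, hG, fun _ => h3, fun _ => h4⟩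
            · exact ⟨E V, hE V hV, fun _ => le_rfl, fun h => absurd h hV'⟩
            · exact ⟨E' V, hE' V hV', fun h => absurd h hV, fun _ => le_rfl⟩
            · exact ⟨0, .bt _, fun h => absurd h hV, fun h => absurd h hV'⟩
          choose G hG h3 h4 using key
          have aux : ∀ (C : Value →₀ ℝ≥0) (K : Value → (Value →₀ ℝ≥0)), C ≤ F →
              (∀ V ∈ C.support, K V ≤ G V) →
              ∑ V ∈ C.support, C V • K V ≤ ∑ V ∈ F.support, F V • G V := by
            intro C K hC hK W
            rw [sum_superset (s := C.support ∪ F.support) Finset.subset_union_left K,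
              sum_superset (s := C.support ∪ F.support) Finset.subset_union_right G]
            simp only [Finsupp.finsetSum_apply, Finsupp.smul_apply, smul_eq_mul]
            refine Finset.sum_le_sum fun V _ => ?_
            by_cases hV : V ∈ C.support
            · exact mul_le_mul' (hC V) (hK V hV W)
            · rw [Finsupp.notMem_support_iff.1 hV, zero_mul]
              exact zero_le
          exact ⟨_, .ba G hF fun V _ => hG V, aux D E h1 h3, aux D' E' h2 h4⟩

/-- A lower approximation has total mass at most one. -/
theorem BigStep.sum_le_one {M : Closed} {D : Value →₀ ℝ≥0} (h : BigStep M D) :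
    ∀ s : Finset Value, ∑ V ∈ s, D V ≤ 1 := by
  classical
  induction h with
  | bt M => intro s; simp
  | bv P =>
      intro s
      simp only [Finsupp.single_apply, Finset.sum_ite_eq]
      split_ifs <;> simp
  | @bs M N D E hM hN ihM ihN =>
      intro s
      simp only [Finsupp.add_apply, Finsupp.smul_apply, smul_eq_mul, Finset.sum_add_distrib,
        ← Finset.mul_sum]
      calc (1 / 2 : ℝ≥0) * ∑ V ∈ s, D V + 1 / 2 * ∑ V ∈ s, E V
          ≤ 1 / 2 * 1 + 1 / 2 * 1 := by gcongr <;> simp_all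
        _ = 1 := by rw [mul_one]; exact add_halves 1
  | @ba M N D E hM hE ihM ihE =>
      intro s
      simp only [Finsupp.finsetSum_apply, Finsupp.smul_apply, smul_eq_mul]
      rw [Finset.sum_comm]
      simp only [← Finset.mul_sum]
      calc ∑ V ∈ D.support, D V * ∑ W ∈ s, E V W
          ≤ ∑ V ∈ D.support, D V * 1 :=
            Finset.sum_le_sum fun V hV => by gcongr; exact ihE V hV s
        _ ≤ 1 := by simpa using ihM D.support

/-- The semantics of a closed term: the least upper bound of its lower approximations. -/
def sem (M : Closed) (V : Value) : ℝ≥0∞ :=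
  ⨆ D : {D : Value →₀ ℝ≥0 // BigStep M D}, ((D.1 V : ℝ≥0) : ℝ≥0∞)

/-- The semantics of a closed term is a (partial) value distribution. -/
theorem sem_tsum_le_one (M : Closed) : ∑' V : Value, sem M V ≤ 1 := by
  rw [ENNReal.tsum_eq_iSup_sum]
  refine iSup_le fun s => ?_
  unfold sem
  rw [ENNReal.finsetSum_iSup]
  · refine iSup_le fun D => ?_
    exact_mod_cast D.2.sum_le_one s
  · intro D D'
    obtain ⟨F, hF, h1, h2⟩ := D.2.directed D'.2
    exact ⟨⟨F, hF⟩, fun V => ⟨by exact_mod_cast h1 V, by exact_mod_cast h2 V⟩⟩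

/-! ## Multisorted labelled Markov chains, probabilistic simulation and bisimulation -/

/-- A multisorted labelled Markov chain: a countable set `S` of states, each of which belongs to one
of a family (indexed by `I`) of disjoint sorts, a set `L` of labels, and a transition probability
matrix. -/
structure LMC (S L I : Type) [Countable S] where
  prob : S → L → S → ℝ≥0∞
  prob_le_one : ∀ s l, ∑' t : S, prob s l t ≤ 1
  sort : S → I

namespace LMC

variable {S L I : Type} [Countable S]

/-- The probability to move from `s` into the set `X` under the label `l`. -/
def probSet (C : LMC S L I) (s : S) (l : L) (X : Set S) : ℝ≥0∞ := ∑' t : X, C.prob s l t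

/-- Probabilistic simulations on a multisorted labelled Markov chain. -/
structure IsSimulation (C : LMC S L I) (R : S → S → Prop) : Prop where
  refl : ∀ s, R s s
  trans : ∀ s t u, R s t → R t u → R s u
  sort_eq : ∀ s t, R s t → C.sort s = C.sort t
  prob_le : ∀ s t, R s t → ∀ (l : L) (X : Set S),
    C.probSet s l X ≤ C.probSet t l {y | ∃ x ∈ X, R x y}

/-- Probabilistic bisimulations on a multisorted labelled Markov chain; `{v | R u v}` is the
equivalence class of `u`. -/
structure IsBisimulation (C : LMC S L I) (R : S → S → Prop) : Prop where
  equivalence : Equivalence R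
  sort_eq : ∀ s t, R s t → C.sort s = C.sort t
  prob_eq : ∀ s t, R s t → ∀ (l : L) (u : S),
    C.probSet s l {v | R u v} = C.probSet t l {v | R u v}

/-- Probabilistic similarity: the union of all probabilistic simulations. -/
def Similar (C : LMC S L I) (s t : S) : Prop := ∃ R, C.IsSimulation R ∧ R s t

/-- Probabilistic bisimilarity: the union of all probabilistic bisimulations. -/
def Bisimilar (C : LMC S L I) (s t : S) : Prop := ∃ R, C.IsBisimulation R ∧ R s t

end LMC

/-! ## Probabilistic applicative similarity and bisimilarity -/

/-- States: closed terms (left) and distinguished values (right). -/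
abbrev State : Type := Closed ⊕ Value

/-- Labels: closed terms (left) and the evaluation label `τ` (right). -/
abbrev Label : Type := Closed ⊕ Unit

open Classical in
/-- The transition probability matrix: a term evaluates to distinguished values according to its
semantics, a distinguished value `λx.P` goes to `P{N/x}` with probability one when it receives
the closed term `N`, and there are no other transitions. -/
def transProb : State → Label → State → ℝ≥0∞
  | .inl M, .inr _, .inr V => sem M V
  | .inr V, .inl N, .inl M => if M = V.body.inst N then 1 else 0
  | _, _, _ => 0

theorem transProb_le_one (s : State) (l : Label) : ∑' t : State, transProb s l t ≤ 1 := by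
  rw [Summable.tsum_sum ENNReal.summable ENNReal.summable]
  rcases s with M | V <;> rcases l with N | _ <;> simp [transProb, sem_tsum_le_one]

/-- The calculus as a multisorted labelled Markov chain. -/
def chain : LMC State Label Bool where
  prob := transProb
  prob_le_one := transProb_le_one
  sort := Sum.isLeft

/-- Probabilistic applicative similarity, on closed terms. -/
def PAS (M N : Closed) : Prop := chain.Similar (.inl M) (.inl N)

/-- Probabilistic applicative bisimilarity, on closed terms. -/
def PAB (M N : Closed) : Prop := chain.Bisimilar (.inl M) (.inl N)

/-! ## Relations on open terms, congruences -/

/-- Relations on open terms: sets of triples `(xs, M, N)` where the free variables of `M` and `N`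
are among the finite set `xs`. -/
def TermRel : Type := ∀ xs : Finset Var, Term xs → Term xs → Prop

/-- The open extension of a relation on closed terms: all closing substitutions are considered. -/
def openExt (R : Closed → Closed → Prop) : TermRel :=
  fun xs M N => ∀ σ : {x : Var // x ∈ xs} → Closed, R (close σ M) (close σ N)

namespace TermRel

structure Compatible (R : TermRel) : Prop where
  com1 : ∀ (xs : Finset Var) (x : Var) (hx : x ∈ xs), R xs (Tm.fvar ⟨x, hx⟩) (Tm.fvar ⟨x, hx⟩)
  com2 : ∀ (xs : Finset Var) (x : Var), x ∉ xs → ∀ M N : Term (insert x xs),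
    R (insert x xs) M N → R xs (abs x M) (abs x N)
  com3 : ∀ (xs : Finset Var) (M N L P : Term xs),
    R xs M N → R xs L P → R xs (Tm.app M L) (Tm.app N P)
  com4 : ∀ (xs : Finset Var) (M N L P : Term xs),
    R xs M N → R xs L P → R xs (Tm.choice M L) (Tm.choice N P)

/-- A precongruence is a compatible preorder. -/
structure Precongruence (R : TermRel) : Prop where
  compatible : R.Compatible
  refl : ∀ (xs : Finset Var) (M : Term xs), R xs M M
  trans : ∀ (xs : Finset Var) (M N L : Term xs), R xs M N → R xs N L → R xs M L

/-- A congruence is a compatible equivalence relation. -/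
structure Congruence (R : TermRel) : Prop where
  compatible : R.Compatible
  equivalence : ∀ xs : Finset Var, Equivalence (R xs)

end TermRel

end ProbLambda

end

/-!
The proof is Howe's method. A relation `R` between points lifts to discrete measures by requiring
`p X ≤ q (R X)` for every set `X`, and similarity is the greatest fixed point of a monotone operator
built from this lifting. Take contexts whose holes are named by pairs of similar terms, so that each
context has a lower and an upper filling, and relate the lower filling of a context to every term
above its upper filling. This relation contains every pair that compatibility with application and
choice asks for, so it suffices that it is a post-fixed point of the operator, which is shown by
induction on the approximations of the semantics.

The case of an application rests on the stability of the lifting under mixtures, that is, on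
`∑ p a * f a ≤ ∑ q b * g b` for `f` and `g` with `f a ≤ g b` whenever `R a b`. Integrating over the
superlevel sets of `f` and `g` (the layer cake formula) turns this into the defining inequality of
the lifting, so that neither couplings nor a max-flow min-cut argument are needed.

For bisimilarity, every class of the symmetric part of a simulation is a difference of two upper
closed sets of finite mass, and related measures agree on such sets. Hence bisimilarity is the
symmetric part of similarity.
-/

noncomputable section

namespace ProbLambda

/-! ## Substitution -/

namespace Tm

variable {A B C : Type} {n m k : ℕ}

theorem subst_rename (ρ : Fin n → Fin m) (σ : A → Tm B k) (θ : Fin m → Tm B k) (M : Tm A n) :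
    subst σ θ (rename ρ M) = subst σ (fun i => θ (ρ i)) M := by
  induction M generalizing m k with
  | fvar | bvar => rfl
  | lam M ih =>
      simp only [rename, subst, ih]
      congr 2
      funext i
      cases i using Fin.cases <;> rfl
  | app M N ihM ihN | choice M N ihM ihN => simp only [rename, subst, ihM, ihN]

theorem rename_rename (ρ : Fin n → Fin m) (ρ' : Fin m → Fin k) (M : Tm A n) :
    rename ρ' (rename ρ M) = rename (fun i => ρ' (ρ i)) M := by
  induction M generalizing m k with
  | fvar | bvar => rfl
  | lam M ih =>
      simp only [rename, ih]
      congr 2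
      funext i
      cases i using Fin.cases <;> rfl
  | app M N ihM ihN | choice M N ihM ihN => simp only [rename, ihM, ihN]

theorem rename_shift (ρ : Fin n → Fin m) (M : Tm A n) :
    rename (Fin.cases 0 (fun i => (ρ i).succ)) (shift M) = shift (rename ρ M) := by
  simp only [shift, rename_rename, Fin.cases_succ]

theorem rename_subst (σ : A → Tm B m) (θ : Fin n → Tm B m) (ρ : Fin m → Fin k) (M : Tm A n) :
    rename ρ (subst σ θ M) = subst (fun a => rename ρ (σ a)) (fun i => rename ρ (θ i)) M := by
  induction M generalizing m k with
  | fvar | bvar => rfl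
  | lam M ih =>
      simp only [rename, subst, ih, rename_shift]
      congr 2
      funext i
      cases i using Fin.cases with
      | zero => rfl
      | succ i => exact rename_shift ρ (θ i)
  | app M N ihM ihN | choice M N ihM ihN => simp only [rename, subst, ihM, ihN]

theorem subst_shift (σ : A → Tm B m) (θ : Fin n → Tm B m) (M : Tm A n) :
    subst (fun a => shift (σ a)) (Fin.cases (bvar 0) (fun i => shift (θ i))) (shift M) =
      shift (subst σ θ M) := by
  simp only [shift, subst_rename, rename_subst, Fin.cases_succ]

theorem subst_subst (σ : A → Tm B m) (θ : Fin n → Tm B m) (σ' : B → Tm C k)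
    (θ' : Fin m → Tm C k) (M : Tm A n) :
    subst σ' θ' (subst σ θ M) =
      subst (fun a => subst σ' θ' (σ a)) (fun i => subst σ' θ' (θ i)) M := by
  induction M generalizing m k with
  | fvar | bvar => rfl
  | lam M ih =>
      simp only [subst, ih, subst_shift]
      congr 2
      funext i
      cases i using Fin.cases with
      | zero => rfl
      | succ i => exact subst_shift σ' θ' (θ i)
  | app M N ihM ihN | choice M N ihM ihN => simp only [subst, ihM, ihN]

theorem cases_bvar_shift :
    (Fin.cases (bvar 0) (fun i => shift (bvar i)) : Fin (n + 1) → Tm A (n + 1)) = bvar := by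
  funext i
  cases i using Fin.cases <;> rfl

theorem subst_fvar_bvar (M : Tm A n) : subst fvar bvar M = M := by
  induction M with
  | fvar | bvar => rfl
  | lam M ih => exact congrArg lam (cases_bvar_shift ▸ ih)
  | app M N ihM ihN | choice M N ihM ihN => simp only [subst, ihM, ihN]

theorem elim0_eq_bvar : (Fin.elim0 : Fin 0 → Tm A 0) = bvar := funext fun i => i.elim0

/-- A term without pending binders, seen as a term below `n` binders. -/
def weaken (M : Tm A 0) : Tm A n := subst fvar Fin.elim0 M

theorem weaken_zero (M : Tm A 0) : (weaken M : Tm A 0) = M := by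
  rw [weaken, elim0_eq_bvar, subst_fvar_bvar]

theorem shift_weaken (M : Tm A 0) : shift (weaken M : Tm A n) = weaken M := by
  rw [shift, weaken, rename_subst]
  exact congrArg (fun θ => subst fvar θ M) (funext fun i => i.elim0)

theorem subst_weaken (σ : A → Tm B m) (θ : Fin n → Tm B m) (M : Tm A 0) :
    subst σ θ (weaken M) = subst σ Fin.elim0 M := by
  rw [weaken, subst_subst]
  exact congrArg (fun θ => subst σ θ M) (funext fun i => i.elim0)

/-- Substitution of terms without pending binders for the free variables of a term, which may itself
lie below `n` binders. -/
def fill (σ : A → Tm B 0) (M : Tm A n) : Tm B n := subst (fun a => weaken (σ a)) bvar M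

theorem fill_fvar (σ : A → Tm B 0) (a : A) : fill σ (fvar a : Tm A 0) = σ a := weaken_zero (σ a)

theorem fill_lam (σ : A → Tm B 0) (M : Tm A (n + 1)) : fill σ (lam M) = lam (fill σ M) := by
  simp only [fill, subst, shift_weaken, cases_bvar_shift]

theorem fill_eq_subst (σ : A → Tm B 0) (M : Tm A 0) : fill σ M = subst σ Fin.elim0 M := by
  simp only [fill, weaken_zero, elim0_eq_bvar]

theorem inst_fill (σ : A → Tm B 0) (P : Tm A 1) (N : Tm B 0) :
    inst (fill σ P) N = subst σ (fun _ => N) P := by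
  simp only [inst, fill, subst_subst, subst_weaken, elim0_eq_bvar, subst_fvar_bvar, subst]

theorem fill_inst (σ : A → Tm B 0) (P : Tm A 1) (N : Tm A 0) :
    fill σ (inst P N) = inst (fill σ P) (fill σ N) := by
  rw [inst_fill, inst, fill_eq_subst, subst_subst, ← fill_eq_subst]
  rfl

/-- A term without free variables, seen as a term over an arbitrary set of free variables. -/
def embed [IsEmpty A] (M : Tm A n) : Tm B n := subst isEmptyElim bvar M

theorem fill_embed [IsEmpty A] (σ : B → Tm A 0) (M : Tm A n) : fill σ (embed M) = M := by
  rw [fill, embed, subst_subst]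
  conv_rhs => rw [← subst_fvar_bvar M]
  exact congrArg (fun τ => subst τ bvar M) (funext isEmptyElim)

end Tm

/-! ## Discrete measures and the lifting of relations -/

section Lifting

variable {α β γ : Type*} {p p' : α → ℝ≥0∞} {q q' : β → ℝ≥0∞} {R R' : α → β → Prop}

theorem tsum_iSup_of_directed {ι : Type*} {f : α → ι → ℝ≥0∞}
    (hf : ∀ i j, ∃ k, ∀ a, f a i ≤ f a k ∧ f a j ≤ f a k) :
    ∑' a, ⨆ i, f a i = ⨆ i, ∑' a, f a i := by
  simp only [ENNReal.tsum_eq_iSup_sum, ENNReal.finsetSum_iSup hf]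
  exact iSup_comm

/-- The mass that the discrete measure with density `p` gives to the set `X`. -/
def mass (p : α → ℝ≥0∞) (X : Set α) : ℝ≥0∞ := ∑' a : X, p a

theorem mass_zero (X : Set α) : mass (0 : α → ℝ≥0∞) X = 0 := tsum_zero

theorem mass_mono (h : p ≤ p') {X Y : Set α} (hXY : X ⊆ Y) : mass p X ≤ mass p' Y :=
  (ENNReal.tsum_mono_subtype p hXY).trans (ENNReal.tsum_le_tsum fun a => h a)

theorem mass_le_tsum (p : α → ℝ≥0∞) (X : Set α) : mass p X ≤ ∑' a, p a :=
  ENNReal.tsum_comp_le_tsum_of_injective Subtype.val_injective p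

theorem mass_inter_support (p : α → ℝ≥0∞) (X : Set α) :
    mass p (X ∩ Function.support p) = mass p X := by
  rw [mass, mass, tsum_subtype, tsum_subtype, Set.indicator_inter_support]

theorem mass_indicator_singleton (a : α) (X : Set α) :
    mass (Set.indicator {a} 1) X = X.indicator 1 a := by
  rw [mass, tsum_subtype, tsum_eq_single a fun b hb => ?_]
  · by_cases ha : a ∈ X <;> simp [ha]
  · simp [Set.indicator, hb]

theorem mass_sumElim (p : α → ℝ≥0∞) (q : β → ℝ≥0∞) (X : Set (α ⊕ β)) :
    mass (Sum.elim p q) X = mass p (Sum.inl ⁻¹' X) + mass q (Sum.inr ⁻¹' X) := by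
  simp only [mass, tsum_subtype]
  exact Summable.tsum_sum ENNReal.summable ENNReal.summable

theorem mass_add_mass_diff (p : α → ℝ≥0∞) {X Y : Set α} (h : X ⊆ Y) :
    mass p X + mass p (Y \ X) = mass p Y := by
  conv_rhs => rw [← Set.union_sdiff_cancel h]
  exact (ENNReal.summable.tsum_union_disjoint Set.disjoint_sdiff_right ENNReal.summable).symm

theorem mass_preimage (p : α → ℝ≥0∞) (f : α → γ) (Y : Set γ) :
    mass p (f ⁻¹' Y) = ∑' c : Y, mass p (f ⁻¹' {(c : γ)}) := by
  rw [← Set.biUnion_preimage_singleton f Y, Set.biUnion_eq_iUnion]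
  refine ENNReal.tsum_biUnion fun c _ d _ hcd => ?_
  exact Disjoint.preimage f (Set.disjoint_singleton.2 (Subtype.coe_ne_coe.2 hcd))

/-- The mixture of the discrete measures with densities `k a`, with weights `p a`. -/
def mixture (p : α → ℝ≥0∞) (k : α → γ → ℝ≥0∞) : γ → ℝ≥0∞ := fun c => ∑' a, p a * k a c

theorem mass_mixture (p : α → ℝ≥0∞) (k : α → γ → ℝ≥0∞) (X : Set γ) :
    mass (mixture p k) X = ∑' a, p a * mass (k a) X := by
  simp only [mass, mixture, ← ENNReal.tsum_mul_left]
  exact ENNReal.tsum_comm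

theorem mixture_iSup_left {ι : Type*} {p : ι → α → ℝ≥0∞} (hp : Directed (· ≤ ·) p)
    (k : α → γ → ℝ≥0∞) : mixture (⨆ i, p i) k = ⨆ i, mixture (p i) k := by
  ext c
  simp only [mixture, iSup_apply, ENNReal.iSup_mul]
  refine tsum_iSup_of_directed fun i j => (hp i j).imp fun l hl a => ?_
  exact ⟨mul_le_mul_left (hl.1 a) _, mul_le_mul_left (hl.2 a) _⟩

theorem mixture_iSup_right {ι : α → Type*} [∀ a, Nonempty (ι a)] (p : α → ℝ≥0∞)
    {k : ∀ a, ι a → γ → ℝ≥0∞} (hk : ∀ a, Directed (· ≤ ·) (k a)) :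
    mixture p (fun a => ⨆ i, k a i) = ⨆ i : ∀ a, ι a, mixture p (fun a => k a (i a)) := by
  ext c
  have hchoice (a : α) : ⨆ i, p a * k a i c = ⨆ i : ∀ a, ι a, p a * k a (i a) c :=
    ((Function.surjective_eval a).iSup_comp fun i => p a * k a i c).symm
  simp only [mixture, iSup_apply, ENNReal.mul_iSup, hchoice]
  refine tsum_iSup_of_directed fun i j => ?_
  choose l hl using fun a => hk a (i a) (j a)
  exact ⟨l, fun a => ⟨mul_le_mul_right ((hl a).1 c) _, mul_le_mul_right ((hl a).2 c) _⟩⟩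

open MeasureTheory in
theorem volume_Ioi_inter_ofReal_lt (c : ℝ≥0∞) :
    volume ({t : ℝ | ENNReal.ofReal t < c} ∩ Set.Ioi 0) = c := by
  induction c with
  | top => simp
  | coe c =>
      have h : {t : ℝ | ENNReal.ofReal t < c} ∩ Set.Ioi 0 = Set.Ioo 0 (c : ℝ) := by
        ext t
        refine and_comm.trans (and_congr_right fun ht : 0 < t => ?_)
        rw [Set.mem_ofPred_eq, ← ENNReal.ofReal_coe_nnreal,
          ENNReal.ofReal_lt_ofReal_iff_of_nonneg ht.le]
      rw [h, Real.volume_Ioo, sub_zero, ENNReal.ofReal_coe_nnreal]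

open MeasureTheory in
theorem tsum_mul_eq_lintegral_mass [Countable α] (p f : α → ℝ≥0∞) :
    ∑' a, p a * f a = ∫⁻ t in Set.Ioi (0 : ℝ), mass p {a | ENNReal.ofReal t < f a} := by
  let layer (a : α) : Set ℝ := {t | ENNReal.ofReal t < f a}
  have hlayer (a : α) : MeasurableSet (layer a) :=
    measurableSet_lt ENNReal.measurable_ofReal measurable_const
  have hmass (t : ℝ) :
      mass p {a | ENNReal.ofReal t < f a} = ∑' a, p a * (layer a).indicator 1 t := by
    rw [mass, tsum_subtype]
    refine tsum_congr fun a => ?_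
    by_cases h : ENNReal.ofReal t < f a <;> simp [layer, h]
  have hmeas (a : α) : Measurable ((layer a).indicator (1 : ℝ → ℝ≥0∞)) :=
    measurable_one.indicator (hlayer a)
  simp only [hmass]
  rw [lintegral_tsum fun a => ((hmeas a).const_mul _).aemeasurable]
  refine tsum_congr fun a => ?_
  rw [lintegral_const_mul _ (hmeas a), lintegral_indicator_one (hlayer a),
    Measure.restrict_apply (hlayer a), volume_Ioi_inter_ofReal_lt]

/-- The lifting of a relation between points to a relation between discrete measures, given by
their densities. -/
def RelLift (R : α → β → Prop) (p : α → ℝ≥0∞) (q : β → ℝ≥0∞) : Prop :=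
  ∀ X : Set α, mass p X ≤ mass q {b | ∃ a ∈ X, R a b}

namespace RelLift

theorem mono_left (h : RelLift R p q) (hp : p' ≤ p) : RelLift R p' q :=
  fun X => (mass_mono hp subset_rfl).trans (h X)

theorem mono_right (h : RelLift R p q) (hq : q ≤ q') : RelLift R p q' :=
  fun X => (h X).trans (mass_mono hq subset_rfl)

theorem mono_rel (h : RelLift R p q) (hR : R ≤ R') : RelLift R' p q :=
  fun X => (h X).trans (mass_mono le_rfl fun b ⟨a, ha, hab⟩ => ⟨a, ha, hR a b hab⟩)

theorem comp {S : β → γ → Prop} {r : γ → ℝ≥0∞} (h : RelLift R p q) (h' : RelLift S q r) :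
    RelLift (Relation.Comp R S) p r := by
  refine fun X => ((h X).trans (h' _)).trans (mass_mono le_rfl ?_)
  rintro c ⟨b, ⟨a, ha, hab⟩, hbc⟩
  exact ⟨a, ha, b, hab, hbc⟩

theorem eq (p : α → ℝ≥0∞) : RelLift Eq p p :=
  fun _ => mass_mono le_rfl fun a ha => ⟨a, ha, rfl⟩

theorem zero (R : α → β → Prop) (q : β → ℝ≥0∞) : RelLift R 0 q := by
  simp [RelLift, mass]

theorem indicator_singleton_left_iff {a : α} :
    RelLift R (Set.indicator {a} 1) q ↔ 1 ≤ mass q {b | R a b} := by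
  simp only [RelLift, mass_indicator_singleton]
  refine ⟨fun h => by simpa using h {a}, fun h X => ?_⟩
  by_cases ha : a ∈ X
  · rw [Set.indicator_of_mem ha]
    exact h.trans (mass_mono le_rfl fun b hab => ⟨a, ha, hab⟩)
  · rw [Set.indicator_of_notMem ha]
    exact zero_le

theorem indicator_singleton_iff {a : α} {b : β} :
    RelLift R (Set.indicator {a} 1) (Set.indicator {b} 1) ↔ R a b := by
  rw [indicator_singleton_left_iff, mass_indicator_singleton]
  by_cases h : R a b <;> simp [h]

theorem sumElim_zero_iff {δ ε : Type*} {T : δ ⊕ α → ε ⊕ β → Prop} :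
    RelLift T (Sum.elim 0 p) (Sum.elim 0 q) ↔
      RelLift (fun a b => T (.inr a) (.inr b)) p q := by
  simp only [RelLift, mass_sumElim, mass_zero, zero_add]
  refine ⟨fun h X => ?_, fun h X => (h _).trans (mass_mono le_rfl ?_)⟩
  · have hX := h (Sum.inr '' X)
    rw [Set.preimage_image_eq _ Sum.inr_injective] at hX
    refine hX.trans (mass_mono le_rfl ?_)
    rintro b ⟨_, ⟨a, ha, rfl⟩, hab⟩
    exact ⟨a, ha, hab⟩
  · rintro b ⟨a, ha, hab⟩
    exact ⟨_, ha, hab⟩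

theorem add (h : RelLift R p q) (h' : RelLift R p' q') : RelLift R (p + p') (q + q') := by
  intro X
  simp only [mass, Pi.add_apply, ENNReal.tsum_add]
  exact add_le_add (h X) (h' X)

theorem const_smul (h : RelLift R p q) (c : ℝ≥0∞) : RelLift R (c • p) (c • q) := by
  intro X
  simp only [mass, Pi.smul_apply, smul_eq_mul, ENNReal.tsum_mul_left]
  exact mul_le_mul_right (h X) c

theorem iSup_left {ι : Type*} {p : ι → α → ℝ≥0∞} (hp : Directed (· ≤ ·) p)
    (h : ∀ i, RelLift R (p i) q) : RelLift R (⨆ i, p i) q := by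
  intro X
  simp only [mass, iSup_apply]
  rw [tsum_iSup_of_directed (f := fun (a : X) i => p i a) fun i j =>
    (hp i j).imp fun k hk a => ⟨hk.1 a, hk.2 a⟩]
  exact iSup_le fun i => h i X

theorem tsum_mul_le_tsum_mul [Countable α] [Countable β] {f : α → ℝ≥0∞} {g : β → ℝ≥0∞}
    (h : RelLift R p q) (hfg : ∀ a b, p a ≠ 0 → R a b → f a ≤ g b) :
    ∑' a, p a * f a ≤ ∑' b, q b * g b := by
  rw [tsum_mul_eq_lintegral_mass, tsum_mul_eq_lintegral_mass]
  refine MeasureTheory.lintegral_mono fun t => ?_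
  rw [← mass_inter_support]
  refine (h _).trans (mass_mono le_rfl ?_)
  rintro b ⟨a, ⟨ht, ha⟩, hab⟩
  exact lt_of_lt_of_le ht (hfg a b ha hab)

theorem mixture [Countable α] [Countable β] {γ' : Type*} {T : γ → γ' → Prop}
    {k : α → γ → ℝ≥0∞} {k' : β → γ' → ℝ≥0∞} (h : RelLift R p q)
    (hk : ∀ a b, p a ≠ 0 → R a b → RelLift T (k a) (k' b)) :
    RelLift T (mixture p k) (mixture q k') := by
  intro X
  rw [mass_mixture, mass_mixture]
  exact h.tsum_mul_le_tsum_mul fun a b ha hab => hk a b ha hab X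

variable {T : α → α → Prop}

theorem of_equivalence (hT : Equivalence T)
    (h : ∀ a, mass p {b | T a b} = mass p' {b | T a b}) : RelLift T p p' := by
  intro X
  let cls : α → Quotient ⟨T, hT⟩ := Quotient.mk _
  have hcls {a b : α} : cls a = cls b ↔ T a b := Quotient.eq
  have hclass (a : α) : cls ⁻¹' {cls a} = {b | T a b} := by
    ext b
    exact hcls.trans ⟨hT.symm, hT.symm⟩
  have hsat : {b | ∃ a ∈ X, T a b} = cls ⁻¹' (cls '' X) := by
    ext b
    exact exists_congr fun a => and_congr_right fun _ => hcls.symm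
  have hmass : mass p {b | ∃ a ∈ X, T a b} = mass p' {b | ∃ a ∈ X, T a b} := by
    rw [hsat, mass_preimage, mass_preimage]
    refine tsum_congr ?_
    rintro ⟨_, a, -, rfl⟩
    simp only [hclass, h]
  have hX : X ⊆ {b | ∃ a ∈ X, T a b} := fun a ha => ⟨a, ha, hT.refl a⟩
  exact (mass_mono le_rfl hX).trans hmass.le

theorem mass_le_of_upperClosed (h : RelLift T p p') {X : Set α}
    (hX : ∀ a ∈ X, ∀ b, T a b → b ∈ X) : mass p X ≤ mass p' X :=
  (h X).trans (mass_mono le_rfl fun b ⟨a, ha, hab⟩ => hX a ha b hab)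

/-- The class of `a` is a difference of two upper closed sets. -/
theorem mass_antisymmRel_eq [IsTrans α T] (h : RelLift T p p') (h' : RelLift T p' p)
    (hp : ∑' a, p a ≠ ∞) (a : α) :
    mass p {b | AntisymmRel T a b} = mass p' {b | AntisymmRel T a b} := by
  let above : Set α := {b | T a b}
  let strict : Set α := {b | T a b ∧ ¬ T b a}
  have heq {X : Set α} (hX : ∀ b ∈ X, ∀ c, T b c → c ∈ X) : mass p X = mass p' X :=
    le_antisymm (h.mass_le_of_upperClosed hX) (h'.mass_le_of_upperClosed hX)
  have habove : mass p above = mass p' above := heq fun b hb c hbc => _root_.trans hb hbc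
  have hstrict : mass p strict = mass p' strict :=
    heq fun b hb c hbc => ⟨_root_.trans hb.1 hbc, fun hca => hb.2 (_root_.trans hbc hca)⟩
  have hclass : {b | AntisymmRel T a b} = above \ strict := by
    ext b
    simp only [AntisymmRel, above, strict, Set.mem_ofPred_eq, Set.mem_sdiff]
    tauto
  have hsub : strict ⊆ above := fun b hb => hb.1
  have hfin : mass p strict ≠ ∞ := ((mass_le_tsum p strict).trans_lt hp.lt_top).ne
  rw [← ENNReal.add_right_inj hfin, hclass, mass_add_mass_diff p hsub, hstrict,
    mass_add_mass_diff p' hsub, habove]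

end RelLift

end Lifting

/-! ## Similarity and bisimilarity as fixed points -/

namespace LMC

variable {S L I : Type} [Countable S] {C : LMC S L I} {R : S → S → Prop}

/-- The monotone operator on relations whose post-fixed preorders are the simulations on `C`. -/
def simStep (C : LMC S L I) : (S → S → Prop) →o (S → S → Prop) where
  toFun R s t := C.sort s = C.sort t ∧ ∀ l, RelLift R (C.prob s l) (C.prob t l)
  monotone' _ _ hR _ _ h := ⟨h.1, fun l => (h.2 l).mono_rel hR⟩

theorem IsSimulation.le_simStep (h : C.IsSimulation R) : R ≤ C.simStep R :=
  fun s t hst => ⟨h.sort_eq s t hst, h.prob_le s t hst⟩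

theorem gfp_simStep_refl (C : LMC S L I) (s : S) : C.simStep.gfp s s := by
  have hpost : Eq ≤ C.simStep Eq := by
    rintro s _ rfl
    exact ⟨rfl, fun l => RelLift.eq _⟩
  exact C.simStep.le_gfp hpost s s rfl

theorem gfp_simStep_trans {s t u : S} (hst : C.simStep.gfp s t) (htu : C.simStep.gfp t u) :
    C.simStep.gfp s u := by
  have hpost : Relation.Comp C.simStep.gfp C.simStep.gfp ≤
      C.simStep (Relation.Comp C.simStep.gfp C.simStep.gfp) := by
    rintro s u ⟨t, hst, htu⟩
    rw [← C.simStep.map_gfp] at hst htu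
    exact ⟨hst.1.trans htu.1, fun l => (hst.2 l).comp (htu.2 l)⟩
  exact C.simStep.le_gfp hpost s u ⟨t, hst, htu⟩

theorem isSimulation_gfp (C : LMC S L I) : C.IsSimulation C.simStep.gfp where
  refl := C.gfp_simStep_refl
  trans _ _ _ := gfp_simStep_trans
  sort_eq s t h := by
    rw [← C.simStep.map_gfp] at h
    exact h.1
  prob_le s t h := by
    rw [← C.simStep.map_gfp] at h
    exact h.2

theorem similar_eq_gfp (C : LMC S L I) : C.Similar = C.simStep.gfp := by
  ext s t
  constructor
  · rintro ⟨R, hR, hst⟩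
    exact C.simStep.le_gfp hR.le_simStep s t hst
  · exact fun hst => ⟨_, C.isSimulation_gfp, hst⟩

theorem isSimulation_similar (C : LMC S L I) : C.IsSimulation C.Similar :=
  C.similar_eq_gfp ▸ C.isSimulation_gfp

theorem IsBisimulation.isSimulation (h : C.IsBisimulation R) : C.IsSimulation R where
  refl := h.equivalence.refl
  trans _ _ _ := h.equivalence.trans
  sort_eq := h.sort_eq
  prob_le s t hst l := RelLift.of_equivalence h.equivalence (h.prob_eq s t hst l)

theorem IsSimulation.isPreorder (h : C.IsSimulation R) : IsPreorder S R where
  refl := h.refl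
  trans := h.trans

theorem IsSimulation.isBisimulation_antisymmRel (h : C.IsSimulation R) :
    C.IsBisimulation (AntisymmRel R) where
  equivalence :=
    have := h.isPreorder
    (AntisymmRel.setoid S R).iseqv
  sort_eq s t hst := h.sort_eq s t hst.1
  prob_eq s t hst l :=
    have := h.isPreorder
    RelLift.mass_antisymmRel_eq (h.prob_le s t hst.1 l) (h.prob_le t s hst.2 l)
      ((C.prob_le_one s l).trans_lt ENNReal.one_lt_top).ne

theorem bisimilar_eq_antisymmRel (C : LMC S L I) : C.Bisimilar = AntisymmRel C.Similar := by
  ext s t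
  constructor
  · rintro ⟨R, hR, hst⟩
    exact ⟨⟨R, hR.isSimulation, hst⟩, ⟨R, hR.isSimulation, hR.equivalence.symm hst⟩⟩
  · exact fun hst => ⟨_, C.isSimulation_similar.isBisimulation_antisymmRel, hst⟩

end LMC

/-! ## Approximations and the semantics -/

/-- Closed terms below `n` pending binders; the bodies of the closed abstractions for `n = 1`. -/
abbrev ClosedTm (n : ℕ) : Type := Tm {x : Var // x ∈ (∅ : Finset Var)} n

/-- The density of a finitely supported distribution on values. -/
def weight (D : Value →₀ ℝ≥0) (V : Value) : ℝ≥0∞ := D V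

theorem weight_mono : Monotone weight := fun _ _ h V => ENNReal.coe_le_coe.2 (h V)

theorem weight_zero : weight 0 = 0 := funext fun _ => ENNReal.coe_zero

theorem weight_single_one (V : Value) : weight (Finsupp.single V 1) = Set.indicator {V} 1 := by
  classical
  ext W
  simp [weight, Finsupp.single_apply, Set.indicator_apply, eq_comm, apply_ite]

theorem weight_add (D E : Value →₀ ℝ≥0) : weight (D + E) = weight D + weight E := by
  ext V
  simp [weight]

theorem weight_smul (c : ℝ≥0) (D : Value →₀ ℝ≥0) : weight (c • D) = (c : ℝ≥0∞) • weight D := by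
  ext V
  simp [weight]

theorem weight_sum_smul (D : Value →₀ ℝ≥0) (E : Value → Value →₀ ℝ≥0) :
    weight (∑ V ∈ D.support, D V • E V) = mixture (weight D) (fun V => weight (E V)) := by
  ext W
  rw [mixture, tsum_eq_sum (s := D.support) fun _ hV => ?_]
  · simp [weight, Finsupp.finsetSum_apply]
  · simp [weight, Finsupp.notMem_support_iff.1 hV]

theorem sem_eq_iSup (M : Closed) : sem M = ⨆ D : {D // BigStep M D}, weight D := by
  ext V
  simp only [sem, weight, iSup_apply]

theorem BigStep.weight_le_sem {M : Closed} {D : Value →₀ ℝ≥0} (h : BigStep M D) :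
    weight D ≤ sem M :=
  sem_eq_iSup M ▸ le_iSup (fun D : {D // BigStep M D} => weight D) ⟨D, h⟩

theorem directed_weight (M : Closed) :
    Directed (· ≤ ·) fun D : {D // BigStep M D} => weight D := by
  intro D D'
  obtain ⟨F, hF, hDF, hDF'⟩ := D.2.directed D'.2
  exact ⟨⟨F, hF⟩, weight_mono hDF, weight_mono hDF'⟩

theorem relLift_sem_left {β : Type*} {M : Closed} {R : Value → β → Prop} {q : β → ℝ≥0∞}
    (h : ∀ D, BigStep M D → RelLift R (weight D) q) : RelLift R (sem M) q :=
  sem_eq_iSup M ▸ RelLift.iSup_left (directed_weight M) fun D => h D D.2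

theorem weight_half_add_half (D E : Value →₀ ℝ≥0) :
    weight ((1 / 2 : ℝ≥0) • D + (1 / 2 : ℝ≥0) • E) =
      (2⁻¹ : ℝ≥0∞) • weight D + (2⁻¹ : ℝ≥0∞) • weight E := by
  rw [weight_add, weight_smul, weight_smul, one_div, ENNReal.coe_inv_two]

theorem half_sem_add_half_sem_le (M N : Closed) :
    (2⁻¹ : ℝ≥0∞) • sem M + (2⁻¹ : ℝ≥0∞) • sem N ≤ sem (Tm.choice M N) := by
  intro V
  have : Nonempty {D // BigStep M D} := ⟨⟨0, .bt M⟩⟩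
  have : Nonempty {D // BigStep N D} := ⟨⟨0, .bt N⟩⟩
  simp only [Pi.add_apply, Pi.smul_apply, smul_eq_mul, sem_eq_iSup M, sem_eq_iSup N, iSup_apply,
    ENNReal.mul_iSup]
  refine ENNReal.iSup_add_iSup_le fun D E => ?_
  have h := (BigStep.bs D.2 E.2).weight_le_sem V
  rwa [weight_half_add_half] at h

theorem mixture_sem_le (M N : Closed) :
    mixture (sem M) (fun V => sem (V.body.inst N)) ≤ sem (Tm.app M N) := by
  have (V : Value) : Nonempty {E // BigStep (V.body.inst N) E} := ⟨⟨0, .bt _⟩⟩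
  simp only [sem_eq_iSup M, sem_eq_iSup (Tm.inst _ N)]
  rw [mixture_iSup_left (directed_weight M)]
  refine iSup_le fun D => ?_
  rw [mixture_iSup_right _ fun V => directed_weight (V.body.inst N)]
  refine iSup_le fun E => ?_
  have h := (BigStep.ba (fun V => (E V).1) D.2 fun V _ => (E V).2).weight_le_sem
  rwa [weight_sum_smul] at h

theorem relLift_sem_lam {P Q : ClosedTm 1} {R : Value → Value → Prop}
    (h : R (.mk P) (.mk Q)) :
    RelLift R (weight (Finsupp.single (.mk P) 1)) (sem (.lam Q)) := by
  refine RelLift.mono_right ?_ (BigStep.bv Q).weight_le_sem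
  rw [weight_single_one, weight_single_one]
  exact RelLift.indicator_singleton_iff.2 h

theorem relLift_sem_app {D : Value →₀ ℝ≥0} {E : Value → Value →₀ ℝ≥0} {M N : Closed}
    {R T : Value → Value → Prop} (hD : RelLift R (weight D) (sem M))
    (hE : ∀ V W, V ∈ D.support → R V W → RelLift T (weight (E V)) (sem (W.body.inst N))) :
    RelLift T (weight (∑ V ∈ D.support, D V • E V)) (sem (.app M N)) := by
  rw [weight_sum_smul]
  refine RelLift.mono_right (hD.mixture fun V W hV hVW => hE V W ?_ hVW) (mixture_sem_le M N)
  exact Finsupp.mem_support_iff.2 (ENNReal.coe_ne_zero.1 hV)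

theorem relLift_sem_choice {D E : Value →₀ ℝ≥0} {M N : Closed} {R : Value → Value → Prop}
    (hD : RelLift R (weight D) (sem M)) (hE : RelLift R (weight E) (sem N)) :
    RelLift R (weight ((1 / 2 : ℝ≥0) • D + (1 / 2 : ℝ≥0) • E)) (sem (.choice M N)) := by
  rw [weight_half_add_half]
  exact ((hD.const_smul _).add (hE.const_smul _)).mono_right (half_sem_add_half_sem_le M N)

/-! ## Applicative similarity as a fixed point -/

section ApplicativeSimilarity

theorem chain_prob_eval (M : Closed) (u : Unit) :
    chain.prob (.inl M) (.inr u) = Sum.elim (0 : Closed → ℝ≥0∞) (sem M) := by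
  ext s
  cases s <;> rfl

theorem chain_prob_apply (V : Value) (N : Closed) :
    chain.prob (.inr V) (.inl N) = Set.indicator {.inl (V.body.inst N)} 1 := by
  classical
  ext s
  cases s <;> simp [chain, transProb, Set.indicator_apply]

variable {R : State → State → Prop}

theorem chain_simStep_inl {M N : Closed} :
    chain.simStep R (.inl M) (.inl N) ↔
      RelLift (fun V W => R (.inr V) (.inr W)) (sem M) (sem N) := by
  refine ⟨fun h => RelLift.sumElim_zero_iff.1 ?_, fun h => ⟨rfl, ?_⟩⟩
  · simpa only [chain_prob_eval] using h.2 (.inr ())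
  · rintro (L | u)
    · exact RelLift.zero R _
    · simpa only [chain_prob_eval] using RelLift.sumElim_zero_iff.2 h

theorem chain_simStep_inr {V W : Value} :
    chain.simStep R (.inr V) (.inr W) ↔
      ∀ N, R (.inl (V.body.inst N)) (.inl (W.body.inst N)) := by
  refine ⟨fun h N => RelLift.indicator_singleton_iff.1 ?_, fun h => ⟨rfl, ?_⟩⟩
  · simpa only [chain_prob_apply] using h.2 (.inl N)
  · rintro (N | u)
    · simpa only [chain_prob_apply] using RelLift.indicator_singleton_iff.2 (h N)
    · exact RelLift.zero R _

/-- The relation between values whose bodies are related under every closed argument. -/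
def ValueRel (R : Closed → Closed → Prop) (V W : Value) : Prop :=
  ∀ N, R (V.body.inst N) (W.body.inst N)

/-- The monotone operator on relations between closed terms whose greatest fixed point is
applicative similarity: it merges an evaluation step with the application step that follows. -/
def appSimStep : (Closed → Closed → Prop) →o (Closed → Closed → Prop) where
  toFun R M N := RelLift (ValueRel R) (sem M) (sem N)
  monotone' _ _ hR _ _ h := h.mono_rel fun _ _ hVW N => hR _ _ (hVW N)

theorem pas_eq_gfp : PAS = appSimStep.gfp := by
  have hPAS : PAS = fun M N => chain.simStep.gfp (.inl M) (.inl N) := by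
    simp only [← chain.similar_eq_gfp]
    rfl
  apply le_antisymm
  · refine appSimStep.le_gfp fun M N hMN => ?_
    rw [hPAS, ← chain.simStep.map_gfp] at hMN
    refine (chain_simStep_inl.1 hMN).mono_rel fun V W hVW => ?_
    rw [← chain.simStep.map_gfp] at hVW
    exact hPAS ▸ chain_simStep_inr.1 hVW
  · let G : Closed → Closed → Prop := appSimStep.gfp
    have hpost : Sum.LiftRel G (ValueRel G) ≤ chain.simStep (Sum.LiftRel G (ValueRel G)) := by
      rintro _ _ (hMN | hVW)
      · rw [show G = appSimStep G from appSimStep.map_gfp.symm] at hMN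
        exact chain_simStep_inl.2 (hMN.mono_rel fun _ _ => Sum.LiftRel.inr)
      · exact chain_simStep_inr.2 fun L => Sum.LiftRel.inl (hVW L)
    intro M N hMN
    exact hPAS ▸ chain.simStep.le_gfp hpost _ _ (Sum.LiftRel.inl hMN)

theorem pas_iff_relLift {M N : Closed} : PAS M N ↔ RelLift (ValueRel PAS) (sem M) (sem N) := by
  rw [pas_eq_gfp]
  exact iff_of_eq (congrFun₂ appSimStep.map_gfp.symm M N)

theorem pab_eq_antisymmRel : PAB = AntisymmRel PAS := by
  ext M N
  exact iff_of_eq (congrFun₂ chain.bisimilar_eq_antisymmRel (.inl M) (.inl N))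

instance : Std.Refl PAS := ⟨fun M => chain.isSimulation_similar.refl (.inl M)⟩

instance : IsTrans Closed PAS := ⟨fun _ _ _ => chain.isSimulation_similar.trans _ _ _⟩

end ApplicativeSimilarity

/-! ## The lifting of a relation to contexts -/

section Howe

variable {R : Closed → Closed → Prop}

/-- The names of the holes of contexts for `R`: a hole named by a pair of related terms can be
filled with either of them. -/
abbrev Hole (R : Closed → Closed → Prop) : Type := {p : Closed × Closed // R p.1 p.2}

/-- The context with every hole filled with the first term of the pair that names it. -/
def lower {n : ℕ} (C : Tm (Hole R) n) : ClosedTm n :=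
  C.fill fun h => h.1.1

/-- The context with every hole filled with the second term of the pair that names it. -/
def upper {n : ℕ} (C : Tm (Hole R) n) : ClosedTm n :=
  C.fill fun h => h.1.2

/-- Howe's lifting of `R` to closed terms, presented through contexts. -/
def Howe (R : Closed → Closed → Prop) (M N : Closed) : Prop :=
  ∃ C : Tm (Hole R) 0, lower C = M ∧ R (upper C) N

/-- Howe's lifting of `R` to values: the context is an abstraction, and the values above its upper
filling are those with pointwise related bodies. -/
def HoweValue (R : Closed → Closed → Prop) (V W : Value) : Prop :=
  ∃ P : Tm (Hole R) 1, Value.mk (lower P) = V ∧ ValueRel R (Value.mk (upper P)) W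

theorem lower_embed {n : ℕ} (M : ClosedTm n) :
    lower (M.embed : Tm (Hole R) n) = M := Tm.fill_embed _ M

theorem upper_embed {n : ℕ} (M : ClosedTm n) :
    upper (M.embed : Tm (Hole R) n) = M := Tm.fill_embed _ M

theorem Value.mk_body (V : Value) : Value.mk V.body = V := by
  obtain ⟨M, hM⟩ := V
  cases M <;> first | rfl | exact hM.elim

theorem ValueRel.howeValue {V W : Value} (h : ValueRel R V W) : HoweValue R V W := by
  refine ⟨V.body.embed, ?_, ?_⟩
  · rw [lower_embed, Value.mk_body]
  · rwa [upper_embed, Value.mk_body]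

theorem HoweValue.trans_valueRel [IsTrans Closed R] {V W Z : Value} (h : HoweValue R V W)
    (h' : ValueRel R W Z) : HoweValue R V Z :=
  h.imp fun _ hP => ⟨hP.1, fun N => _root_.trans (hP.2 N) (h' N)⟩

theorem HoweValue.howe_inst {V W : Value} (h : HoweValue R V W) (C : Tm (Hole R) 0) :
    Howe R (V.body.inst (lower C)) (W.body.inst (upper C)) := by
  obtain ⟨P, rfl, hP⟩ := h
  refine ⟨P.inst C, Tm.fill_inst _ P C, ?_⟩
  rw [upper, Tm.fill_inst]
  exact hP (upper C)

theorem howeValue_le_valueRel : HoweValue R ≤ ValueRel (Howe R) := by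
  intro V W h N
  have hN := h.howe_inst (N.embed : Tm (Hole R) 0)
  rwa [lower_embed, upper_embed] at hN

theorem lower_fvar (p : Hole R) : lower (Tm.fvar p : Tm (Hole R) 0) = p.1.1 := Tm.fill_fvar _ p

theorem upper_fvar (p : Hole R) : upper (Tm.fvar p : Tm (Hole R) 0) = p.1.2 := Tm.fill_fvar _ p

theorem rel_of_lower_fvar_eq [IsTrans Closed R] {p : Hole R} {M N : Closed}
    (hM : lower (.fvar p) = M) (hN : R (upper (.fvar p)) N) : R M N := by
  rw [lower_fvar] at hM
  rw [upper_fvar] at hN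
  exact hM ▸ _root_.trans p.2 hN

theorem Howe.lam_left [IsTrans Closed R] {P : ClosedTm 1} {N : Closed}
    (h : Howe R (.lam P) N) :
    R (.lam P) N ∨ ∃ P' : Tm (Hole R) 1, lower P' = P ∧ R (.lam (upper P')) N := by
  obtain ⟨C, hC, hN⟩ := h
  cases C with
  | fvar p => exact .inl (rel_of_lower_fvar_eq hC hN)
  | bvar i => exact i.elim0
  | lam P' =>
      rw [lower, Tm.fill_lam] at hC
      rw [upper, Tm.fill_lam] at hN
      exact .inr ⟨P', Tm.lam.inj hC, hN⟩
  | app | choice => cases hC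

theorem Howe.app_left [IsTrans Closed R] {M L N : Closed} (h : Howe R (.app M L) N) :
    R (.app M L) N ∨
      ∃ C D : Tm (Hole R) 0, lower C = M ∧ lower D = L ∧ R (.app (upper C) (upper D)) N := by
  obtain ⟨C, hC, hN⟩ := h
  cases C with
  | fvar p => exact .inl (rel_of_lower_fvar_eq hC hN)
  | bvar i => exact i.elim0
  | app C D => exact .inr ⟨C, D, (Tm.app.inj hC).1, (Tm.app.inj hC).2, hN⟩
  | lam | choice => cases hC

theorem Howe.choice_left [IsTrans Closed R] {M L N : Closed} (h : Howe R (.choice M L) N) :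
    R (.choice M L) N ∨
      ∃ C D : Tm (Hole R) 0, lower C = M ∧ lower D = L ∧ R (.choice (upper C) (upper D)) N := by
  obtain ⟨C, hC, hN⟩ := h
  cases C with
  | fvar p => exact .inl (rel_of_lower_fvar_eq hC hN)
  | bvar i => exact i.elim0
  | choice C D => exact .inr ⟨C, D, (Tm.choice.inj hC).1, (Tm.choice.inj hC).2, hN⟩
  | lam | app => cases hC

theorem RelLift.howeValue_trans [IsTrans Closed R] (hR : R ≤ appSimStep R) {p : Value → ℝ≥0∞}
    {M N : Closed} (h : RelLift (HoweValue R) p (sem M)) (hMN : R M N) :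
    RelLift (HoweValue R) p (sem N) := by
  refine (h.comp (hR M N hMN)).mono_rel ?_
  rintro V Z ⟨W, hVW, hWZ⟩
  exact hVW.trans_valueRel hWZ

theorem BigStep.relLift_howeValue_of_rel (hR : R ≤ appSimStep R) {M N : Closed} {D : Value →₀ ℝ≥0}
    (h : BigStep M D) (hMN : R M N) : RelLift (HoweValue R) (weight D) (sem N) :=
  ((hR M N hMN).mono_left h.weight_le_sem).mono_rel fun _ _ hVW => hVW.howeValue

/-- The key lemma of Howe's method. The induction is on the approximation and not on the context,
because an application evaluates to an instance of a body, which is a new context. -/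
theorem BigStep.relLift_howeValue [Std.Refl R] [IsTrans Closed R] (hR : R ≤ appSimStep R)
    {M N : Closed} {D : Value →₀ ℝ≥0} (hM : BigStep M D) (h : Howe R M N) :
    RelLift (HoweValue R) (weight D) (sem N) := by
  induction hM generalizing N with
  | bt M =>
      rw [weight_zero]
      exact .zero _ _
  | bv P =>
      rcases h.lam_left with hN | ⟨P, rfl, hN⟩
      · exact (BigStep.bv P).relLift_howeValue_of_rel hR hN
      · have hP : HoweValue R (.mk (lower P)) (.mk (upper P)) := ⟨P, rfl, fun _ => refl _⟩
        exact (relLift_sem_lam hP).howeValue_trans hR hN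
  | ba E hM hE ihM ihE =>
      rcases h.app_left with hN | ⟨C, L, rfl, rfl, hN⟩
      · exact (BigStep.ba E hM hE).relLift_howeValue_of_rel hR hN
      · have hC := ihM ⟨C, rfl, refl _⟩
        have happ := relLift_sem_app hC fun V W hV hVW => ihE V hV (hVW.howe_inst L)
        exact happ.howeValue_trans hR hN
  | bs hM hL ihM ihL =>
      rcases h.choice_left with hN | ⟨C, L, rfl, rfl, hN⟩
      · exact (BigStep.bs hM hL).relLift_howeValue_of_rel hR hN
      · have hchoice := relLift_sem_choice (ihM ⟨C, rfl, refl _⟩) (ihL ⟨L, rfl, refl _⟩)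
        exact hchoice.howeValue_trans hR hN

theorem howe_le_appSimStep [Std.Refl R] [IsTrans Closed R] (hR : R ≤ appSimStep R) :
    Howe R ≤ appSimStep (Howe R) :=
  fun _ _ h => relLift_sem_left fun _ hD =>
    (hD.relLift_howeValue hR h).mono_rel howeValue_le_valueRel

theorem exists_lower_eq_upper_eq {M N : Closed} (h : R M N) :
    ∃ C : Tm (Hole R) 0, lower C = M ∧ upper C = N :=
  ⟨.fvar ⟨(M, N), h⟩, lower_fvar _, upper_fvar _⟩

theorem howe_app [Std.Refl R] {M M' N N' : Closed} (hM : R M M') (hN : R N N') :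
    Howe R (.app M N) (.app M' N') := by
  obtain ⟨C, rfl, rfl⟩ := exists_lower_eq_upper_eq hM
  obtain ⟨D, rfl, rfl⟩ := exists_lower_eq_upper_eq hN
  exact ⟨.app C D, rfl, refl _⟩

theorem howe_choice [Std.Refl R] {M M' N N' : Closed} (hM : R M M') (hN : R N N') :
    Howe R (.choice M N) (.choice M' N') := by
  obtain ⟨C, rfl, rfl⟩ := exists_lower_eq_upper_eq hM
  obtain ⟨D, rfl, rfl⟩ := exists_lower_eq_upper_eq hN
  exact ⟨.choice C D, rfl, refl _⟩

end Howe

theorem howe_pas_le_pas : Howe PAS ≤ PAS := by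
  have hpost : PAS ≤ appSimStep PAS := fun _ _ => pas_iff_relLift.1
  calc Howe PAS ≤ appSimStep.gfp := appSimStep.le_gfp (howe_le_appSimStep hpost)
    _ = PAS := pas_eq_gfp.symm

theorem pas_lam {P Q : ClosedTm 1} (h : ∀ N, PAS (P.inst N) (Q.inst N)) :
    PAS (.lam P) (.lam Q) := by
  refine pas_iff_relLift.2 (relLift_sem_left fun D hD => ?_)
  cases hD with
  | bt => exact weight_zero ▸ .zero _ _
  | bv => exact relLift_sem_lam h

theorem pas_app {M M' N N' : Closed} (hM : PAS M M') (hN : PAS N N') :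
    PAS (.app M N) (.app M' N') := howe_pas_le_pas _ _ (howe_app hM hN)

theorem pas_choice {M M' N N' : Closed} (hM : PAS M M') (hN : PAS N N') :
    PAS (.choice M N) (.choice M' N') := howe_pas_le_pas _ _ (howe_choice hM hN)

/-! ## Open extensions -/

/-- The closing substitution `σ` extended with the closed term `N` for the variable `x`. -/
def extend {xs : Finset Var} (x : Var) (σ : {x : Var // x ∈ xs} → Closed) (N : Closed)
    (y : {y : Var // y ∈ insert x xs}) : Closed :=
  if h : y.1 = x then N else σ ⟨y.1, Finset.mem_of_mem_insert_of_ne y.2 h⟩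

theorem exists_close_abs {xs : Finset Var} (x : Var) (σ : {x : Var // x ∈ xs} → Closed)
    (M : Term (insert x xs)) :
    ∃ P, close σ (abs x M) = Tm.lam P ∧ ∀ N, P.inst N = close (extend x σ N) M := by
  rw [close, ← Tm.fill_eq_subst, abs, Tm.fill_lam]
  refine ⟨_, rfl, fun N => ?_⟩
  rw [Tm.inst_fill, Tm.subst_subst, close]
  congr 1
  · funext y
    unfold extend
    split_ifs <;> rfl
  · funext i
    exact i.elim0

theorem openExt_precongruence {R : Closed → Closed → Prop} [Std.Refl R] [IsTrans Closed R]
    (hlam : ∀ P Q, (∀ N, R (Tm.inst P N) (Tm.inst Q N)) → R (.lam P) (.lam Q))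
    (happ : ∀ M M' N N', R M M' → R N N' → R (.app M N) (.app M' N'))
    (hchoice : ∀ M M' N N', R M M' → R N N' → R (.choice M N) (.choice M' N')) :
    (openExt R).Precongruence where
  compatible :=
    { com1 _ _ _ σ := refl _
      com2 xs x _ M N h σ := by
        obtain ⟨P, hM, hP⟩ := exists_close_abs x σ M
        obtain ⟨Q, hN, hQ⟩ := exists_close_abs x σ N
        rw [hM, hN]
        refine hlam P Q fun L => ?_
        rw [hP, hQ]
        exact h (extend x σ L)
      com3 _ _ _ _ _ hM hN σ := happ _ _ _ _ (hM σ) (hN σ)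
      com4 _ _ _ _ _ hM hN σ := hchoice _ _ _ _ (hM σ) (hN σ) }
  refl _ _ _ := refl _
  trans _ _ _ _ h h' σ := _root_.trans (h σ) (h' σ)

namespace TermRel

theorem Precongruence.congruence_antisymmRel {R : TermRel} (h : R.Precongruence) :
    Congruence fun xs => AntisymmRel (R xs) where
  compatible :=
    { com1 xs _ _ := ⟨h.refl xs _, h.refl xs _⟩
      com2 xs x hx M N hMN :=
        ⟨h.compatible.com2 xs x hx M N hMN.1, h.compatible.com2 xs x hx N M hMN.2⟩
      com3 xs M N L P hMN hLP :=
        ⟨h.compatible.com3 xs M N L P hMN.1 hLP.1, h.compatible.com3 xs N M P L hMN.2 hLP.2⟩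
      com4 xs M N L P hMN hLP :=
        ⟨h.compatible.com4 xs M N L P hMN.1 hLP.1, h.compatible.com4 xs N M P L hMN.2 hLP.2⟩ }
  equivalence xs :=
    have : IsPreorder (Term xs) (R xs) := { refl := h.refl xs, trans := h.trans xs }
    (AntisymmRel.setoid (Term xs) (R xs)).iseqv

end TermRel

theorem openExt_antisymmRel (R : Closed → Closed → Prop) :
    openExt (AntisymmRel R) = fun xs => AntisymmRel (openExt R xs) := by
  funext xs M N
  exact propext forall_and

theorem openExt_pas_precongruence : (openExt PAS).Precongruence :=
  openExt_precongruence (fun _ _ => pas_lam) (fun _ _ _ _ => pas_app) (fun _ _ _ _ => pas_choice)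

end ProbLambda

end

theorem mainTheorem1 :
    (ProbLambda.openExt ProbLambda.PAS).Precongruence ∧
      (ProbLambda.openExt ProbLambda.PAB).Congruence := by
  refine ⟨ProbLambda.openExt_pas_precongruence, ?_⟩
  rw [ProbLambda.pab_eq_antisymmRel, ProbLambda.openExt_antisymmRel]
  exact ProbLambda.openExt_pas_precongruence.congruence_antisymmRel
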